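/- For a real matrix $M$ let $\|M\|_2$ be the operator norm induced by the Euclidean vector norms, $\|M\|_F$ the Frobenius norm, and $M^\dagger$ the Moore--Penrose inverse. If a real $m\times n$ matrix $M$ has rank $n$, its leverage scores are $\|e_j^TQ\|_2^2$, $1\le j\le m$, where $Q$ is any $m\times n$ matrix whose columns form an orthonormal basis of $\mathrm{range}(M)$ (the values do not depend on the choice of $Q$). Theorem. Let $A$ and $\Delta A$ be real $m\times n$ matrices with $\mathrm{rank}(A)=n$ and $\|\Delta A\|_2\,\|A^\dagger\|_2\le 1/2$. Then $\mathrm{rank}(A+\Delta A)=n$. Let $\ell_j$, $1\le j\le m$, be the leverage scores of $A$, and let $\tilde\ell_j=\|e_j^T\tilde Q\|_2^2$ be the leverage scores of $A+\Delta A$ computed from any thin QR decomposition $A+\Delta A=\tilde Q\tilde R$, where $\tilde Q\in\mathbb R^{m\times n}$ satisfies $\tilde Q^T\tilde Q=I_n$ and $\tilde R\in\mathbb R^{n\times n}$ is upper triangular. Then for every $1\le j\le m$ with $\ell_j>0$, $$\frac{|\tilde\ell_j-\ell_j|}{\ell_j}\le 12\left(\sqrt{\frac{1-\ell_j}{\ell_j}}+3\,\frac{\kappa_2(A)\,\mathrm{sr}(A)^{1/2}}{\ell_j}\,\epsilon_F\right)\kappa_2(A)\,\mathrm{sr}(A)^{1/2}\,\epsilon_F,$$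 where $\kappa_2(A)=\|A\|_2\|A^\dagger\|_2$, $\mathrm{sr}(A)=\|A\|_F^2/\|A\|_2^2$ and $\epsilon_F=\|\Delta A\|_F/\|A\|_F$. -/

import Mathlib

open scoped Matrix

namespace LeverageQR

noncomputable section

section Norms

open scoped Matrix.Norms.L2Operator in
/-- The two-norm (operator norm with respect to the Euclidean vector norms) of a real matrix. -/
def twoNorm {m n : ℕ} (A : Matrix (Fin m) (Fin n) ℝ) : ℝ := ‖A‖

open scoped Matrix.Norms.Frobenius in
/-- The Frobenius norm of a real matrix. -/
def frobNorm {m n : ℕ} (A : Matrix (Fin m) (Fin n) ℝ) : ℝ := ‖A‖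

end Norms

/-- The four Penrose conditions: `X` is the Moore-Penrose inverse of the real matrix `A`. -/
structure IsMoorePenrose {m n : ℕ} (A : Matrix (Fin m) (Fin n) ℝ)
    (X : Matrix (Fin n) (Fin m) ℝ) : Prop where
  mul_mul_self : A * X * A = A
  self_mul_mul : X * A * X = X
  left_symm : (A * X)ᵀ = A * X
  right_symm : (X * A)ᵀ = X * A

/-- The Moore-Penrose inverse is unique. -/
theorem IsMoorePenrose.unique {m n : ℕ} {A : Matrix (Fin m) (Fin n) ℝ}
    {X Y : Matrix (Fin n) (Fin m) ℝ} (hX : IsMoorePenrose A X) (hY : IsMoorePenrose A Y) :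
    X = Y := by
  have h1 : A * X = A * Y := by
    calc A * X = (A * X)ᵀ := hX.left_symm.symm
      _ = ((A * Y) * (A * X))ᵀ := by
          rw [← Matrix.mul_assoc (A * Y) A X, hY.mul_mul_self]
      _ = (A * X) * (A * Y) := by
          rw [Matrix.transpose_mul, hX.left_symm, hY.left_symm]
      _ = A * Y := by rw [← Matrix.mul_assoc (A * X) A Y, hX.mul_mul_self]
  have h2 : X * A = Y * A := by
    calc X * A = (X * A)ᵀ := hX.right_symm.symm
      _ = ((X * A) * (Y * A))ᵀ := by
          rw [Matrix.mul_assoc X A (Y * A), ← Matrix.mul_assoc A Y A, hY.mul_mul_self]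
      _ = (Y * A) * (X * A) := by
          rw [Matrix.transpose_mul, hX.right_symm, hY.right_symm]
      _ = Y * A := by rw [Matrix.mul_assoc Y A (X * A), ← Matrix.mul_assoc A X A, hX.mul_mul_self]
  calc X = X * A * X := hX.self_mul_mul.symm
    _ = Y * A * Y := by rw [h2, Matrix.mul_assoc, h1, ← Matrix.mul_assoc]
    _ = Y := hY.self_mul_mul

/-- Every real matrix has a Moore-Penrose inverse. -/
theorem exists_isMoorePenrose {m n : ℕ} (A : Matrix (Fin m) (Fin n) ℝ) :
    ∃ X, IsMoorePenrose A X := by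
  have hS : (Aᵀ * A).IsHermitian := by
    simpa using Matrix.isHermitian_conjTranspose_mul_self A
  obtain ⟨U, d, hU, hSU⟩ : ∃ (U : Matrix (Fin n) (Fin n) ℝ) (d : Fin n → ℝ),
      Uᵀ * U = 1 ∧ Aᵀ * A = U * Matrix.diagonal d * Uᵀ := by
    refine ⟨hS.eigenvectorUnitary, hS.eigenvalues, ?_, ?_⟩
    · simpa [Matrix.star_eq_conjTranspose] using
        Unitary.coe_star_mul_self hS.eigenvectorUnitary
    · have h := hS.spectral_theorem
      rw [Unitary.conjStarAlgAut_apply] at h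
      simpa [Matrix.star_eq_conjTranspose, Function.comp_def] using h
  set S := Aᵀ * A with hSdef
  set P := U * Matrix.diagonal (fun i => (d i)⁻¹) * Uᵀ with hP
  have hmul : ∀ a b : Fin n → ℝ, (U * Matrix.diagonal a * Uᵀ) * (U * Matrix.diagonal b * Uᵀ)
      = U * Matrix.diagonal (fun i => a i * b i) * Uᵀ := by
    intro a b
    calc _ = U * Matrix.diagonal a * (Uᵀ * U) * Matrix.diagonal b * Uᵀ := by
          simp only [Matrix.mul_assoc]
      _ = _ := by
          rw [hU, Matrix.mul_one, Matrix.mul_assoc U, Matrix.diagonal_mul_diagonal]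
  have hT : ∀ a : Fin n → ℝ, (U * Matrix.diagonal a * Uᵀ)ᵀ = U * Matrix.diagonal a * Uᵀ := by
    intro a
    simp [Matrix.transpose_mul, Matrix.mul_assoc]
  have hPT : Pᵀ = P := hT _
  have hPS : P * S = U * Matrix.diagonal (fun i => (d i)⁻¹ * d i) * Uᵀ := by
    rw [hSU, hP, hmul]
  have hSPS : S * (P * S) = S := by
    rw [hPS, hSU, hmul]
    congr 3
    ext i
    by_cases h : d i = 0 <;> simp [h]
  have hPSP : P * S * P = P := by
    rw [hPS, hP, hmul]
    congr 3
    ext i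
    by_cases h : d i = 0 <;> simp [h]
  have hA : A * (P * S) = A := by
    have h0 : Aᵀ * A * (P * S - 1) = 0 := by
      rw [Matrix.mul_sub, Matrix.mul_one, ← hSdef, hSPS, sub_self]
    have h1 : A * (P * S - 1) = 0 := by
      have := (Matrix.conjTranspose_mul_self_mul_eq_zero A (P * S - 1)).1 (by simpa using h0)
      exact this
    rw [Matrix.mul_sub, Matrix.mul_one] at h1
    exact sub_eq_zero.1 h1
  refine ⟨P * Aᵀ, ?_, ?_, ?_, ?_⟩
  · rw [Matrix.mul_assoc, Matrix.mul_assoc P, ← hSdef, hA]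
  · rw [Matrix.mul_assoc P Aᵀ A, ← hSdef, ← Matrix.mul_assoc, hPSP]
  · rw [Matrix.transpose_mul, Matrix.transpose_mul, hPT, Matrix.transpose_transpose,
      Matrix.mul_assoc]
  · rw [Matrix.mul_assoc P Aᵀ A, ← hSdef, hPS, hT]

/-- The Moore-Penrose inverse of a real matrix. -/
def pinv {m n : ℕ} (A : Matrix (Fin m) (Fin n) ℝ) : Matrix (Fin n) (Fin m) ℝ :=
  Classical.choose (exists_isMoorePenrose A)

theorem isMoorePenrose_pinv {m n : ℕ} (A : Matrix (Fin m) (Fin n) ℝ) :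
    IsMoorePenrose A (pinv A) :=
  Classical.choose_spec (exists_isMoorePenrose A)

/-- The two-norm condition number with respect to left inversion, `‖A‖₂ ‖A†‖₂`. -/
def condNumber {m n : ℕ} (A : Matrix (Fin m) (Fin n) ℝ) : ℝ := twoNorm A * twoNorm (pinv A)

/-- The stable rank `‖A‖_F² / ‖A‖₂²`. -/
def stableRank {m n : ℕ} (A : Matrix (Fin m) (Fin n) ℝ) : ℝ := frobNorm A ^ 2 / twoNorm A ^ 2

/-- The columns of `Q` form an orthonormal basis of the column space of `A`. -/
def IsOrthonormalRangeBasis {m n : ℕ} (A Q : Matrix (Fin m) (Fin n) ℝ) : Prop :=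
  Qᵀ * Q = 1 ∧ LinearMap.range Q.mulVecLin = LinearMap.range A.mulVecLin

/-- `B = Q R` is a thin QR decomposition: `Q` has orthonormal columns and the square matrix `R` is
upper triangular. No sign convention is imposed on the diagonal of `R`. -/
def IsThinQR {m n : ℕ} (B Q : Matrix (Fin m) (Fin n) ℝ) (R : Matrix (Fin n) (Fin n) ℝ) : Prop :=
  Qᵀ * Q = 1 ∧ R.IsUpperTriangular ∧ B = Q * R

/-- The squared Euclidean norm of the `j`th row of `Q`; the `j`th leverage score of `A` when the
columns of `Q` form an orthonormal basis of the column space of `A`. -/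
def rowNormSq {m n : ℕ} (Q : Matrix (Fin m) (Fin n) ℝ) (j : Fin m) : ℝ :=
  ‖WithLp.toLp 2 (Q j)‖ ^ 2

end

end LeverageQR

open LeverageQR

/-! With `U = range A`, `V = range (A + ΔA)`, the scores are `‖P_U e_j‖²` and `‖P_V e_j‖²`. Let `δ =
‖ΔA‖₂‖A†‖₂`. Vectors of `U` lie within relative distance `δ` of `V`, and `P_V` shrinks `Uᗮ` by a
factor `2δ`. Splitting `e_j = x + y` along `U ⊕ Uᗮ` leaves a cross term of order `δ‖x‖‖y‖ =
δ√(ℓ(1-ℓ))` and a remainder of order `δ²` (`abs_norm_sq_starProjection_sub_le`). Finally `κ₂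
sr^{1/2} ε_F` equals `‖ΔA‖_F‖A†‖₂ ≥ δ`. -/

namespace LeverageQR

open scoped RealInnerProductSpace

/-! ### Gaps between the ranges of `f` and `f + g` in an inner product space. -/

section Projections

variable {E F : Type*} [NormedAddCommGroup E] [InnerProductSpace ℝ E]
  [NormedAddCommGroup F] [InnerProductSpace ℝ F]

/-- Perturbation of the squared norm of an orthogonal projection, in terms of the two gaps between
the subspaces. -/
theorem abs_norm_sq_starProjection_sub_le {U V : Submodule ℝ E} [U.HasOrthogonalProjection]
    [V.HasOrthogonalProjection] {δ : ℝ}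
    (hU : ∀ x ∈ U, ‖x - V.starProjection x‖ ≤ δ * ‖x‖)
    (hV : ∀ y ∈ Uᗮ, ‖V.starProjection y‖ ≤ 2 * δ * ‖y‖) (e : E) :
    |‖V.starProjection e‖ ^ 2 - ‖U.starProjection e‖ ^ 2| ≤
      4 * δ * (‖U.starProjection e‖ * ‖e - U.starProjection e‖) + 4 * δ ^ 2 * ‖e‖ ^ 2 := by
  set x := U.starProjection e with hx
  set y := e - x with hy
  have hxU : x ∈ U := U.starProjection_apply_mem e
  have hyU : y ∈ Uᗮ := U.sub_starProjection_mem_orthogonal e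
  have he : e = x + y := by simp [hy]
  have hxy : ‖e‖ ^ 2 = ‖x‖ ^ 2 + ‖y‖ ^ 2 := by
    rw [he, norm_add_sq_real, U.inner_right_of_mem_orthogonal hxU hyU]
    ring
  have hVx : ‖x‖ ^ 2 = ‖V.starProjection x‖ ^ 2 + ‖x - V.starProjection x‖ ^ 2 := by
    simpa using V.norm_sq_eq_add_norm_sq_starProjection x
  have hcross : ⟪V.starProjection x, V.starProjection y⟫ = ⟪x, V.starProjection y⟫ := by
    rw [V.inner_starProjection_left_eq_right,
      V.starProjection_eq_self_iff.2 (V.starProjection_apply_mem y)]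
  have hexp : ‖V.starProjection e‖ ^ 2 - ‖x‖ ^ 2 = 2 * ⟪x, V.starProjection y⟫
      + (‖V.starProjection y‖ ^ 2 - ‖x - V.starProjection x‖ ^ 2) := by
    rw [he, map_add, norm_add_sq_real, hcross, hVx]
    ring
  have h1 : |⟪x, V.starProjection y⟫| ≤ 2 * δ * (‖x‖ * ‖y‖) := by
    calc |⟪x, V.starProjection y⟫| ≤ ‖x‖ * ‖V.starProjection y‖ := abs_real_inner_le_norm _ _
      _ ≤ ‖x‖ * (2 * δ * ‖y‖) := by gcongr; exact hV y hyU
      _ = _ := by ring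
  have h2 : ‖V.starProjection y‖ ^ 2 ≤ 4 * δ ^ 2 * ‖y‖ ^ 2 := by
    calc _ ≤ (2 * δ * ‖y‖) ^ 2 := by gcongr; exact hV y hyU
      _ = _ := by ring
  have h3 : ‖x - V.starProjection x‖ ^ 2 ≤ δ ^ 2 * ‖x‖ ^ 2 := by
    calc _ ≤ (δ * ‖x‖) ^ 2 := by gcongr; exact hU x hxU
      _ = _ := by ring
  have h4 : 0 ≤ δ ^ 2 * ‖x‖ ^ 2 := by positivity
  have h5 : 0 ≤ δ ^ 2 * ‖y‖ ^ 2 := by positivity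
  rw [hexp, hxy]
  -- The two quadratic terms have opposite signs, so each side of the bound needs only one of them.
  rw [abs_le] at h1 ⊢
  constructor <;>
    nlinarith [h1.1, h1.2, sq_nonneg ‖V.starProjection y‖, sq_nonneg ‖x - V.starProjection x‖]

variable {f g : F →ₗ[ℝ] E} {a t : ℝ}

/-- A lower bound for a linear map survives a small perturbation, with half the constant. -/
theorem norm_le_mul_norm_add_apply (ha : 0 ≤ a) (hf : ∀ v, ‖v‖ ≤ a * ‖f v‖)
    (hg : ∀ v, ‖g v‖ ≤ t * ‖v‖) (hta : t * a ≤ 1 / 2) (v : F) :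
    ‖v‖ ≤ 2 * a * ‖(f + g) v‖ := by
  have h1 : ‖f v‖ ≤ ‖(f + g) v‖ + t * ‖v‖ := by
    calc ‖f v‖ = ‖(f + g) v - g v‖ := by simp
      _ ≤ ‖(f + g) v‖ + ‖g v‖ := norm_sub_le _ _
      _ ≤ _ := by gcongr; exact hg v
  have h2 : ‖v‖ ≤ a * (‖(f + g) v‖ + t * ‖v‖) := (hf v).trans (by gcongr)
  have h3 : t * a * ‖v‖ ≤ 1 / 2 * ‖v‖ := by gcongr
  linarith

/-- `f w` and `-g w` differ by `(f + g) w`, hence have the same component orthogonal to `range (f +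
g)`. -/
theorem norm_sub_starProjection_range_le [(LinearMap.range (f + g)).HasOrthogonalProjection]
    (ht : 0 ≤ t) (hf : ∀ v, ‖v‖ ≤ a * ‖f v‖)
    (hg : ∀ v, ‖g v‖ ≤ t * ‖v‖) {x : E} (hx : x ∈ LinearMap.range f) :
    ‖x - (LinearMap.range (f + g)).starProjection x‖ ≤ t * a * ‖x‖ := by
  obtain ⟨w, rfl⟩ := hx
  have hmem : (f + g) w ∈ LinearMap.range (f + g) := LinearMap.mem_range_self _ w
  have hproj : f w - (LinearMap.range (f + g)).starProjection (f w) =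
      (LinearMap.range (f + g))ᗮ.starProjection (-g w) := by
    have h : -g w = f w - (f + g) w := by simp
    rw [h, map_sub, Submodule.starProjection_orthogonal_val,
      Submodule.starProjection_orthogonal_val,
      (Submodule.starProjection_eq_self_iff (K := LinearMap.range (f + g))).2 hmem,
      sub_self, sub_zero]
  calc _ = ‖(LinearMap.range (f + g))ᗮ.starProjection (-g w)‖ := by rw [hproj]
    _ ≤ ‖g w‖ := by simpa using (LinearMap.range (f + g))ᗮ.norm_starProjection_apply_le (-g w)
    _ ≤ t * ‖w‖ := hg w
    _ ≤ t * (a * ‖f w‖) := by gcongr; exact hf w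
    _ = _ := by ring

/-- Writing `P_V y = (f + g) w` gives `‖P_V y‖² = ⟪(f + g) w, y⟫ = ⟪g w, y⟫`, since `y ⊥ f w`. The
factor 2 is the loss in the lower bound for `f + g`. -/
theorem norm_starProjection_range_add_le [(LinearMap.range (f + g)).HasOrthogonalProjection]
    (ht : 0 ≤ t) (ha : 0 ≤ a) (hf : ∀ v, ‖v‖ ≤ a * ‖f v‖)
    (hg : ∀ v, ‖g v‖ ≤ t * ‖v‖) (hta : t * a ≤ 1 / 2) {y : E} (hy : y ∈ (LinearMap.range f)ᗮ) :
    ‖(LinearMap.range (f + g)).starProjection y‖ ≤ 2 * (t * a) * ‖y‖ := by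
  set V := LinearMap.range (f + g)
  obtain ⟨w, hw⟩ : V.starProjection y ∈ LinearMap.range (f + g) := V.starProjection_apply_mem y
  have h1 : ‖V.starProjection y‖ ^ 2 = ⟪g w, y⟫ := by
    have h : ⟪V.starProjection y, V.starProjection y⟫ = ⟪V.starProjection y, y⟫ := by
      rw [← V.inner_starProjection_left_eq_right,
        V.starProjection_eq_self_iff.2 (V.starProjection_apply_mem y)]
    rw [← real_inner_self_eq_norm_sq, h, ← hw, LinearMap.add_apply, inner_add_left,
      Submodule.inner_right_of_mem_orthogonal (LinearMap.mem_range_self f w) hy, zero_add]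
  have h2 : ‖V.starProjection y‖ ^ 2 ≤ 2 * (t * a) * ‖y‖ * ‖V.starProjection y‖ := by
    calc _ = ⟪g w, y⟫ := h1
      _ ≤ ‖g w‖ * ‖y‖ := real_inner_le_norm _ _
      _ ≤ t * (2 * a * ‖V.starProjection y‖) * ‖y‖ := by
        gcongr
        refine (hg w).trans ?_
        gcongr
        rw [← hw]
        exact norm_le_mul_norm_add_apply ha hf hg hta w
      _ = _ := by ring
  rcases (norm_nonneg (V.starProjection y)).eq_or_lt with h0 | h0
  · rw [← h0]; positivity
  · rw [sq] at h2
    exact le_of_mul_le_mul_right h2 h0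

end Projections

/-! ### Matrix norms, pseudoinverse and leverage scores as projections. -/

section Matrices

open Matrix WithLp

variable {m n : ℕ}

theorem twoNorm_nonneg (A : Matrix (Fin m) (Fin n) ℝ) : 0 ≤ twoNorm A := by
  unfold twoNorm
  rw [l2_opNorm_def]
  exact norm_nonneg _

theorem frobNorm_nonneg (A : Matrix (Fin m) (Fin n) ℝ) : 0 ≤ frobNorm A := by
  unfold frobNorm
  rw [frobenius_norm_def]
  positivity

theorem norm_toEuclideanLin_le (A : Matrix (Fin m) (Fin n) ℝ) (v : EuclideanSpace ℝ (Fin n)) :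
    ‖toEuclideanLin A v‖ ≤ twoNorm A * ‖v‖ :=
  l2_opNorm_mulVec A v

theorem frobNorm_sq (A : Matrix (Fin m) (Fin n) ℝ) :
    frobNorm A ^ 2 = ∑ i, ‖toLp 2 (A i)‖ ^ 2 := by
  change ‖toLp 2 fun i => toLp 2 (A i)‖ ^ 2 = _
  rw [PiLp.norm_sq_eq_of_L2]

theorem twoNorm_le_frobNorm (A : Matrix (Fin m) (Fin n) ℝ) : twoNorm A ≤ frobNorm A := by
  unfold twoNorm
  rw [l2_opNorm_def]
  refine ContinuousLinearMap.opNorm_le_bound _ (frobNorm_nonneg A) fun v => ?_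
  refine le_of_sq_le_sq ?_ (mul_nonneg (frobNorm_nonneg A) (norm_nonneg v))
  rw [mul_pow, frobNorm_sq, Finset.sum_mul, PiLp.norm_sq_eq_of_L2]
  -- Cauchy–Schwarz, row by row.
  refine Finset.sum_le_sum fun i _ => ?_
  rw [← mul_pow, Real.norm_eq_abs]
  gcongr
  have h := abs_real_inner_le_norm (toLp 2 (A i)) v
  rw [EuclideanSpace.inner_eq_star_dotProduct, dotProduct_comm] at h
  simpa [mulVec] using h

theorem twoNorm_pos {A : Matrix (Fin m) (Fin n) ℝ} (hA : A ≠ 0) : 0 < twoNorm A := by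
  refine (twoNorm_nonneg A).lt_of_ne fun h => hA ?_
  unfold twoNorm at h
  rw [l2_opNorm_def, eq_comm, norm_eq_zero] at h
  exact (LinearEquiv.map_eq_zero_iff _).1 h

/-- A matrix has full column rank iff its columns are independent. -/
theorem rank_eq_iff_mulVec_injective (A : Matrix (Fin m) (Fin n) ℝ) :
    A.rank = n ↔ Function.Injective A.mulVec := by
  have h := LinearMap.finrank_range_add_finrank_ker A.mulVecLin
  rw [Module.finrank_fin_fun] at h
  rw [Matrix.rank, ← coe_mulVecLin, ← LinearMap.ker_eq_bot, ← Submodule.finrank_eq_zero]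
  omega

theorem pinv_mul_self {A : Matrix (Fin m) (Fin n) ℝ} (hA : A.rank = n) : pinv A * A = 1 := by
  have hinj := (rank_eq_iff_mulVec_injective A).1 hA
  refine Matrix.ext_of_mulVec_single fun i => hinj ?_
  rw [mulVec_mulVec, ← Matrix.mul_assoc, (isMoorePenrose_pinv A).mul_mul_self, one_mulVec]

theorem norm_le_twoNorm_pinv_mul {A : Matrix (Fin m) (Fin n) ℝ} (hA : A.rank = n)
    (v : EuclideanSpace ℝ (Fin n)) : ‖v‖ ≤ twoNorm (pinv A) * ‖toEuclideanLin A v‖ := by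
  have h := norm_toEuclideanLin_le (pinv A) (toEuclideanLin A v)
  rwa [toLpLin_apply _ _ (pinv A), ofLp_toLpLin, toLin'_apply, mulVec_mulVec, pinv_mul_self hA,
    one_mulVec, toLp_ofLp] at h

theorem rank_add_eq {A D : Matrix (Fin m) (Fin n) ℝ} (hA : A.rank = n)
    (hD : twoNorm D * twoNorm (pinv A) ≤ 1 / 2) : (A + D).rank = n := by
  rw [rank_eq_iff_mulVec_injective, ← coe_mulVecLin, ← LinearMap.ker_eq_bot,
    LinearMap.ker_eq_bot']
  intro v hv
  have h := norm_le_mul_norm_add_apply (twoNorm_nonneg _) (norm_le_twoNorm_pinv_mul hA)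
    (norm_toEuclideanLin_le D) hD (toLp 2 v)
  rw [← map_add, toLpLin_apply, ofLp_toLp, ← mulVecLin_apply, hv] at h
  have h0 : toLp 2 v = 0 := by simpa using h
  simpa using h0

/-- The leverage scores are the squared norms of the projections of the coordinate vectors. -/
theorem rowNormSq_eq_norm_sq_starProjection {A Q : Matrix (Fin m) (Fin n) ℝ}
    (hQ : IsOrthonormalRangeBasis A Q) (j : Fin m) :
    rowNormSq Q j = ‖(LinearMap.range (toEuclideanLin A)).starProjection
      (EuclideanSpace.single j 1)‖ ^ 2 := by
  obtain ⟨hQQ, hr⟩ := hQ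
  have hproj : (LinearMap.range (toEuclideanLin A)).starProjection (EuclideanSpace.single j 1) =
      toLp 2 (Q *ᵥ Q j) := by
    -- The row `Q j` is `Qᵀ e_j`, so the candidate is `Q Qᵀ e_j`.
    refine Submodule.eq_starProjection_of_mem_of_inner_eq_zero ?_ ?_
    · obtain ⟨w, hw⟩ : Q *ᵥ Q j ∈ LinearMap.range A.mulVecLin := hr ▸ ⟨Q j, rfl⟩
      exact ⟨toLp 2 w, by rw [← hw]; rfl⟩
    · rintro _ ⟨w, rfl⟩
      obtain ⟨u, hu⟩ : A *ᵥ ofLp w ∈ LinearMap.range Q.mulVecLin := hr ▸ ⟨ofLp w, rfl⟩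
      rw [toLpLin_apply, ← hu, mulVecLin_apply, inner_sub_left, sub_eq_zero,
        EuclideanSpace.inner_single_left, EuclideanSpace.inner_toLp_toLp]
      have h : Q *ᵥ u ⬝ᵥ Q *ᵥ Q j = u ⬝ᵥ Q j := by
        rw [dotProduct_mulVec, ← mulVec_transpose, mulVec_mulVec, hQQ, one_mulVec]
      simpa [h, mulVec] using dotProduct_comm _ _
  have h : Q *ᵥ Q j ⬝ᵥ Q *ᵥ Q j = Q j ⬝ᵥ Q j := by
    rw [dotProduct_mulVec, ← mulVec_transpose, mulVec_mulVec, hQQ, one_mulVec]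
  rw [rowNormSq, hproj, ← real_inner_self_eq_norm_sq, ← real_inner_self_eq_norm_sq,
    EuclideanSpace.inner_toLp_toLp, EuclideanSpace.inner_toLp_toLp]
  simpa using h.symm

/-- `B = Q R` gives `range B ≤ range Q`, and `rank Q ≤ n = rank B` forces equality. -/
theorem IsThinQR.isOrthonormalRangeBasis {B Q : Matrix (Fin m) (Fin n) ℝ}
    {R : Matrix (Fin n) (Fin n) ℝ} (h : IsThinQR B Q R) (hB : B.rank = n) :
    IsOrthonormalRangeBasis B Q := by
  refine ⟨h.1, (Submodule.eq_of_le_of_finrank_le ?_ ?_).symm⟩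
  · rw [h.2.2, mulVecLin_mul]
    exact LinearMap.range_comp_le_range _ _
  · exact (Q.rank_le_width).trans hB.ge

theorem condNumber_mul_sqrt_stableRank_mul {A : Matrix (Fin m) (Fin n) ℝ} (hA : A ≠ 0)
    (D : Matrix (Fin m) (Fin n) ℝ) :
    condNumber A * √(stableRank A) * (frobNorm D / frobNorm A) =
      frobNorm D * twoNorm (pinv A) := by
  have h2 := twoNorm_pos hA
  have hF := h2.trans_le (twoNorm_le_frobNorm A)
  rw [stableRank, ← div_pow, Real.sqrt_sq (by positivity), condNumber]
  field_simp

/-- The absolute form of the leverage score perturbation bound. -/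
theorem abs_rowNormSq_sub_le {A D Q Q' : Matrix (Fin m) (Fin n) ℝ} (hA : A.rank = n)
    (hD : twoNorm D * twoNorm (pinv A) ≤ 1 / 2) (hQ : IsOrthonormalRangeBasis A Q)
    (hQ' : IsOrthonormalRangeBasis (A + D) Q') (j : Fin m) :
    |rowNormSq Q' j - rowNormSq Q j| ≤
      4 * (twoNorm D * twoNorm (pinv A)) * √(rowNormSq Q j * (1 - rowNormSq Q j))
        + 4 * (twoNorm D * twoNorm (pinv A)) ^ 2 := by
  have ha := twoNorm_nonneg (pinv A)
  have ht := twoNorm_nonneg D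
  have hf := norm_le_twoNorm_pinv_mul hA
  have hg := norm_toEuclideanLin_le D
  have h := abs_norm_sq_starProjection_sub_le
    (fun x hx => norm_sub_starProjection_range_le ht hf hg hx)
    (fun y hy => norm_starProjection_range_add_le ht ha hf hg hD hy)
    (EuclideanSpace.single j (1 : ℝ))
  rw [rowNormSq_eq_norm_sq_starProjection hQ', rowNormSq_eq_norm_sq_starProjection hQ, map_add]
  set e : EuclideanSpace ℝ (Fin m) := EuclideanSpace.single j 1
  set U := LinearMap.range (toEuclideanLin A)
  have he : ‖e‖ = 1 := by simp [e]
  have hpyth : 1 - ‖U.starProjection e‖ ^ 2 = ‖e - U.starProjection e‖ ^ 2 := by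
    have := U.norm_sq_eq_add_norm_sq_starProjection e
    rw [U.starProjection_orthogonal_val, he] at this
    linarith
  rw [hpyth, ← mul_pow, Real.sqrt_sq (by positivity)]
  simpa [he] using h

end Matrices

end LeverageQR

open LeverageQR
theorem mainTheorem6 {m n : ℕ} (A ΔA : Matrix (Fin m) (Fin n) ℝ)
    (hA : A.rank = n) (hΔ : twoNorm ΔA * twoNorm (pinv A) ≤ 1 / 2) :
    (A + ΔA).rank = n ∧
    ∀ Q : Matrix (Fin m) (Fin n) ℝ, IsOrthonormalRangeBasis A Q →
    ∀ (Q' : Matrix (Fin m) (Fin n) ℝ) (R' : Matrix (Fin n) (Fin n) ℝ), IsThinQR (A + ΔA) Q' R' →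
    ∀ j : Fin m, 0 < rowNormSq Q j →
      |rowNormSq Q' j - rowNormSq Q j| / rowNormSq Q j ≤
        12 * (Real.sqrt ((1 - rowNormSq Q j) / rowNormSq Q j)
            + 3 * (condNumber A * Real.sqrt (stableRank A) / rowNormSq Q j)
              * (frobNorm ΔA / frobNorm A))
          * condNumber A * Real.sqrt (stableRank A) * (frobNorm ΔA / frobNorm A) := by
  have hrank := rank_add_eq hA hΔ
  refine ⟨hrank, fun Q hQ Q' R' hQR j hj => ?_⟩
  -- A zero matrix of full column rank has `n = 0`, and then every score vanishes.
  have hA0 : A ≠ 0 := by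
    rintro rfl
    rw [Matrix.rank_zero] at hA
    subst hA
    simp [rowNormSq, PiLp.norm_sq_eq_of_L2] at hj
  have hη := condNumber_mul_sqrt_stableRank_mul hA0 ΔA
  have habs := abs_rowNormSq_sub_le hA hΔ hQ (hQR.isOrthonormalRangeBasis hrank) j
  set l := rowNormSq Q j
  set η := frobNorm ΔA * twoNorm (pinv A)
  have ha := twoNorm_nonneg (pinv A)
  have hδ0 : 0 ≤ twoNorm ΔA * twoNorm (pinv A) := mul_nonneg (twoNorm_nonneg _) ha
  have hδη : twoNorm ΔA * twoNorm (pinv A) ≤ η :=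
    mul_le_mul_of_nonneg_right (twoNorm_le_frobNorm ΔA) ha
  have hη0 : 0 ≤ η := hδ0.trans hδη
  have hsqrt : √(l * (1 - l)) = √((1 - l) / l) * l := by
    conv_rhs => rw [← Real.sqrt_sq hj.le, Real.sqrt_sq hj.le]
    rw [show l * (1 - l) = (1 - l) / l * l ^ 2 by field_simp, Real.sqrt_mul' _ (sq_nonneg l),
      Real.sqrt_sq hj.le]
  have hrhs : 12 * (√((1 - l) / l) + 3 * (condNumber A * √(stableRank A) / l)
      * (frobNorm ΔA / frobNorm A)) * condNumber A * √(stableRank A) * (frobNorm ΔA / frobNorm A)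
      = 12 * (√((1 - l) / l) + 3 * (η / l)) * η := by
    rw [← hη]
    ring
  rw [hrhs, div_le_iff₀ hj]
  calc _ ≤ 4 * (twoNorm ΔA * twoNorm (pinv A)) * √(l * (1 - l))
        + 4 * (twoNorm ΔA * twoNorm (pinv A)) ^ 2 := habs
    -- The constants 12 and 36 are slack: the argument gives 4 and 4.
    _ ≤ 12 * η * √(l * (1 - l)) + 36 * η ^ 2 := by gcongr <;> norm_num
    _ = _ := by rw [hsqrt]; field_simp; ring
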